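/- Let $\mathcal C$ be a small category with amalgamation (every span $Y\leftarrow X\to Z$ in $\mathcal C$ can be completed to a commutative square), and let $J_{\mathrm{at}}$ be the atomic topology on $\mathcal C^{\mathrm{op}}$, whose covering sieves are the nonempty sieves. Let $\ell:\mathcal C^{\mathrm{op}}\to \mathrm{Sh}(\mathcal C^{\mathrm{op}},J_{\mathrm{at}})$ be the Yoneda embedding followed by sheafification. An atom of a topos is a non-initial object whose only subobjects are the initial object and itself; atoms form a full subcategory. A category is co-well-founded if for every diagram $(x_i)_{i\in I}$ in it indexed by a nonempty well-ordered set $I$ there is $i\in I$ such that $x_i\to x_j$ is an isomorphism for all $j>i$; a category is well-founded if its opposite is co-well-founded. A group is Noetherian if every ascending chain of its subgroups stabilizes. Suppose that * (C1) $\ell$ is fully faithful and sends every object of $\mathcal C^{\mathrm{op}}$ to an atom; * (C2) $\mathcal C^{\mathrm{op}}$ has pushouts and $\ell$ preserves them; * (C3) $\mathcal C$ is well-founded; * (C4) the automorphism group of every object of $\mathcal C$ is Noetherian. Then the category of atoms of $\mathrm{Sh}(\mathcal C^{\mathrm{op}},J_{\mathrm{at}})$ is co-well-founded, and $\mathrm{Sh}(\mathcal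 C^{\mathrm{op}},J_{\mathrm{at}})$ is locally finitely presentable. -/

import Mathlib

open CategoryTheory CategoryTheory.Limits

universe w w' v u

namespace AtomicTopos

/-- A category is co-well-founded if every chain, that is, every diagram `F` indexed by a
(nonempty) well-ordered poset `I`, stabilizes: there is an index `i` such that the morphisms
`F i ⟶ F j` are isomorphisms for all `j > i`. -/
def IsCoWellFounded (A : Type u) [Category.{v} A] : Prop :=
  ∀ (I : Type w) [LinearOrder I] [WellFoundedLT I] [Nonempty I] (F : I ⥤ A),
    ∃ i : I, ∀ (j : I) (hij : i < j), IsIso (F.map (homOfLE hij.le))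

/-- A category is well-founded if its opposite is co-well-founded. -/
def IsWellFounded (A : Type u) [Category.{v} A] : Prop :=
  IsCoWellFounded.{w} Aᵒᵖ

/-- A group is Noetherian if its subgroups satisfy the ascending chain condition. -/
def IsNoetherianGroup (G : Type u) [Group G] : Prop :=
  WellFoundedGT (Subgroup G)

/-- An object `X` of a topos is an atom if it is not initial and its only
subobjects are the initial one and `X` itself. -/
def isAtomObject (E : Type u) [Category.{v} E] : ObjectProperty E := fun X =>
  IsEmpty (IsInitial X) ∧
    ∀ ⦃U : E⦄ (f : U ⟶ X) [Mono f], Nonempty (IsInitial U) ∨ IsIso f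

/-- The category of atoms of a topos, as a full subcategory. -/
abbrev Atoms (E : Type u) [Category.{v} E] : Type u :=
  (isAtomObject E).FullSubcategory

section

variable (C : Type u) [SmallCategory C]

/-- A category has amalgamation if every span `Y ⟵ X ⟶ Z` in it admits a cocone. -/
def HasAmalgamation : Prop :=
  ∀ ⦃X Y Z : C⦄ (f : X ⟶ Y) (g : X ⟶ Z), ∃ (W : C) (h : Y ⟶ W) (k : Z ⟶ W), f ≫ h = g ≫ k

variable {C}

theorem HasAmalgamation.rightOre (h : HasAmalgamation C) :
    GrothendieckTopology.RightOreCondition Cᵒᵖ := by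
  intro X Y Z yx zx
  obtain ⟨W, a, b, hab⟩ := h yx.unop zx.unop
  exact ⟨Opposite.op W, a.op, b.op, congrArg Quiver.Hom.op hab⟩

/-- The atomic topology on `Cᵒᵖ`: the covering sieves are the nonempty ones.
This is a Grothendieck topology because `C` has amalgamation. -/
abbrev atomicTopology (h : HasAmalgamation C) : GrothendieckTopology Cᵒᵖ :=
  GrothendieckTopology.atomic h.rightOre

/-- The topos of sheaves of sets on `Cᵒᵖ` for the atomic topology. -/
abbrev AtomicSheaves (h : HasAmalgamation C) : Type (u + 1) :=
  Sheaf (atomicTopology h) (Type u)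

/-- The canonical functor from `Cᵒᵖ` to the topos of sheaves on `Cᵒᵖ`: the Yoneda embedding
followed by sheafification. -/
noncomputable abbrev sheafifiedYoneda (h : HasAmalgamation C) : Cᵒᵖ ⥤ AtomicSheaves h :=
  yoneda ⋙ presheafToSheaf (atomicTopology h) (Type u)

end

end AtomicTopos

/-! Both conclusions follow from one stabilization result, `exists_stable_coincidences`: along a
diagram of sheaves, the pairs of arrows on which a section `y` has equal restrictions eventually
stop growing. Sections over `X` are morphisms out of the sheafified representable of `X`, so (C2)
lets them be glued along pushouts. By (C3), extend an image of `y` along `Y ⟶ X` until no image at a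
later stage extends along a non-isomorphism. If two restrictions of such a section agree, gluing on
the pushout shows that they differ by an automorphism in its stabilizer. Stabilizers grow along the
diagram, and by (C4) they become constant. For atoms, a map creating no new coincidences is an
isomorphism, so chains stabilize. For filtered diagrams, a matching family in the presheaf colimit
is already matching at one stage, so this colimit is a sheaf and the inclusion into presheaves is
finitely accessible. -/

namespace AtomicTopos

/-! ### Stabilization of coincidences -/

section Sections

variable {D : Type u} [Category.{v} D]

/-- A presheaf lifts pushouts if compatible sections over the two legs of a pushout square come
from a section over the pushout. -/
def LiftsPushouts (F : Dᵒᵖ ⥤ Type w) : Prop :=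
  ∀ ⦃Z X Y P : D⦄ ⦃f : Z ⟶ X⦄ ⦃g : Z ⟶ Y⦄ ⦃i : X ⟶ P⦄ ⦃j : Y ⟶ P⦄, IsPushout f g i j →
    ∀ (x : F.obj (.op X)) (y : F.obj (.op Y)), F.map f.op x = F.map g.op y →
      ∃ p : F.obj (.op P), F.map i.op p = x ∧ F.map j.op p = y

/-- The automorphisms of `X` fixing a section `x` over `X`. -/
def sectionStabilizer (F : Dᵒᵖ ⥤ Type w) {X : D} (x : F.obj (.op X)) : Subgroup (Aut X) where
  carrier := {σ | F.map σ.hom.op x = x}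
  mul_mem' {σ τ} hσ hτ := by
    change F.map σ.hom.op x = x at hσ
    change F.map τ.hom.op x = x at hτ
    change F.map (τ.hom ≫ σ.hom).op x = x
    rw [op_comp, Functor.map_comp, comp_apply, hσ, hτ]
  one_mem' := by
    change F.map (𝟙 X).op x = x
    simp
  inv_mem' {σ} hσ := by
    change F.map σ.hom.op x = x at hσ
    change F.map σ.inv.op x = x
    have h : σ.inv ≫ σ.hom = 𝟙 X := Iso.inv_hom_id (self := σ)
    conv_lhs => rw [← hσ]
    rw [← comp_apply, ← Functor.map_comp, ← op_comp, h, op_id, Functor.map_id_apply]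

/-- In a co-well-founded category, the relation of being the target of a non-invertible morphism
is well-founded. -/
theorem IsCoWellFounded.wellFounded (h : IsCoWellFounded.{w} D) :
    WellFounded (fun X' X : D ↦ ∃ f : X ⟶ X', ¬ IsIso f) := by
  rw [wellFounded_iff_isEmpty_descending_chain]
  refine ⟨fun ⟨X, hX⟩ ↦ ?_⟩
  choose f hf using hX
  obtain ⟨n, hn⟩ := h (ULift.{w} ℕ)
    ((ULift.orderIso.{w} (α := ℕ)).equivalence.functor ⋙ Functor.ofSequence f)
  refine hf n.down ?_
  rw [← Functor.ofSequence_map_homOfLE_succ f n.down]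
  exact hn ⟨n.down + 1⟩ (Nat.lt_succ_self _)

/-- If `x` does not extend along any non-invertible morphism, two restrictions of `x` agree only
if they differ by an automorphism fixing `x`. -/
theorem LiftsPushouts.exists_aut [HasPushouts D] {F : Dᵒᵖ ⥤ Type w} (hF : LiftsPushouts F)
    {X : D} (x : F.obj (.op X))
    (hx : ∀ ⦃X' : D⦄ (f : X ⟶ X') (x' : F.obj (.op X')), F.map f.op x' = x → IsIso f)
    {Z : D} (a b : Z ⟶ X) (hab : F.map a.op x = F.map b.op x) :
    ∃ σ ∈ sectionStabilizer F x, a ≫ σ.hom = b := by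
  -- Both legs of the pushout of `a` and `b` extend `x`, hence are invertible; the automorphism is
  -- one leg followed by the inverse of the other.
  obtain ⟨p, hp₁, hp₂⟩ := hF (IsPushout.of_hasPushout a b) x x hab
  have := hx _ _ hp₁
  have := hx _ _ hp₂
  refine ⟨asIso (pushout.inl a b) ≪≫ (asIso (pushout.inr a b)).symm, ?_, ?_⟩
  · change F.map (pushout.inl a b ≫ inv (pushout.inr a b)).op x = x
    conv_lhs => rw [← hp₂]
    rw [← comp_apply, ← Functor.map_comp, ← op_comp]
    simpa using hp₁
  · simp [pushout.condition_assoc]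

/-- For a section of a diagram of presheaves lifting pushouts, the coincidences between its
restrictions stabilize at some stage of the diagram. -/
theorem exists_stable_coincidences [HasPushouts D] (hD : IsCoWellFounded.{w} D)
    (hAut : ∀ X : D, IsNoetherianGroup (Aut X))
    {I : Type*} [Category* I] (F : I ⥤ Dᵒᵖ ⥤ Type w') (hF : ∀ i, LiftsPushouts (F.obj i))
    {i₀ : I} {Y : D} (y : (F.obj i₀).obj (.op Y)) :
    ∃ (i : I) (u : i₀ ⟶ i), ∀ ⦃j : I⦄ (t : i ⟶ j) ⦃Z : D⦄ (a b : Z ⟶ Y),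
      (F.obj j).map a.op ((F.map (u ≫ t)).app _ y) =
        (F.obj j).map b.op ((F.map (u ≫ t)).app _ y) →
      (F.obj i).map a.op ((F.map u).app _ y) = (F.obj i).map b.op ((F.map u).app _ y) := by
  -- All stages are allowed at once, so a minimal choice blocks extensions at every later stage too
  -- (`hmax`).
  let S : Set D := {X | ∃ (i : I) (u : i₀ ⟶ i) (x : (F.obj i).obj (.op X)) (g : Y ⟶ X),
    (F.obj i).map g.op x = (F.map u).app _ y}
  obtain ⟨X, ⟨i, u, x, g, hx⟩, hmin⟩ := hD.wellFounded.has_min S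
    ⟨Y, i₀, 𝟙 _, y, 𝟙 _, by simp⟩
  have hmax {k : I} (v : i ⟶ k) ⦃X' : D⦄ (f : X ⟶ X') (x' : (F.obj k).obj (.op X'))
      (hx' : (F.obj k).map f.op x' = (F.map v).app _ x) : IsIso f := by
    by_contra hf
    refine hmin X' ⟨k, u ≫ v, x', g ≫ f, ?_⟩ ⟨f, hf⟩
    simp [hx', ← NatTrans.naturality_apply, hx]
  -- A minimal element for `>` is a maximal stabilizer; it no longer grows after stage `k`.
  let T : Set (Subgroup (Aut X)) := Set.range fun p : Σ k, (i ⟶ k) ↦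
    sectionStabilizer (F.obj p.1) ((F.map p.2).app _ x)
  have : WellFoundedGT (Subgroup (Aut X)) := hAut X
  obtain ⟨_, ⟨⟨k, v⟩, rfl⟩, hH⟩ := (wellFounded_gt (α := Subgroup (Aut X))).has_min T
    ⟨_, ⟨i, 𝟙 _⟩, rfl⟩
  refine ⟨k, u ≫ v, fun j t Z a b hab ↦ ?_⟩
  have key : sectionStabilizer (F.obj j) ((F.map (v ≫ t)).app _ x) =
      sectionStabilizer (F.obj k) ((F.map v).app _ x) := by
    refine (eq_of_le_of_not_lt ?_ (hH _ ⟨⟨j, v ≫ t⟩, rfl⟩)).symm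
    intro σ hσ
    change (F.obj k).map σ.hom.op _ = _ at hσ
    change (F.obj j).map σ.hom.op _ = _
    simp only [Functor.map_comp, NatTrans.comp_app, comp_apply]
    rw [← NatTrans.naturality_apply, hσ]
  have hy {l : I} (s : i ⟶ l) {W : D} (c : W ⟶ Y) :
      (F.obj l).map c.op ((F.map (u ≫ s)).app _ y) =
        (F.obj l).map (c ≫ g).op ((F.map s).app _ x) := by
    simp [← NatTrans.naturality_apply, hx]
  rw [Category.assoc, hy, hy] at hab
  rw [hy, hy]
  obtain ⟨σ, hσ, h⟩ := (hF j).exists_aut _ (hmax (v ≫ t)) _ _ hab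
  rw [key] at hσ
  change (F.obj k).map σ.hom.op _ = _ at hσ
  rw [← h, op_comp (f := a ≫ g), Functor.map_comp, comp_apply]
  exact congrArg _ hσ.symm

end Sections

/-- Inverting an automorphism identifies the automorphism groups of an object of `C` and of
the same object of `Cᵒᵖ`. -/
def autUnopEquiv {C : Type u} [Category.{v} C] (X : Cᵒᵖ) : Aut X ≃* Aut X.unop where
  toFun σ := σ.symm.unop
  invFun σ := σ.symm.op
  left_inv _ := rfl
  right_inv _ := rfl
  map_mul' _ _ := rfl

theorem IsNoetherianGroup.of_mulEquiv {G H : Type*} [Group G] [Group H] (e : G ≃* H)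
    (h : IsNoetherianGroup H) : IsNoetherianGroup G := by
  have : WellFoundedGT (Subgroup H) := h
  exact e.mapSubgroup.toOrderEmbedding.wellFoundedGT

/-! ### Sheaves for the atomic topology and their filtered colimits -/

section Atomic

variable {D : Type u} [Category.{v} D] (hD : GrothendieckTopology.RightOreCondition D)

theorem mem_atomic_of_hom {X Y : D} {S : Sieve X} {f : Y ⟶ X} (hf : S f) :
    S ∈ GrothendieckTopology.atomic hD X :=
  ⟨Y, f, hf⟩

/-- A presheaf is a sheaf for the atomic topology as soon as it satisfies descent along every
single morphism. -/
theorem isSheaf_atomic_of_singleton {F : Dᵒᵖ ⥤ Type w}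
    (hF : ∀ ⦃X Y : D⦄ (f : Y ⟶ X), Presieve.IsSheafFor F (.singleton f)) :
    Presieve.IsSheaf (GrothendieckTopology.atomic hD) F := by
  rintro X S ⟨Y, f, hf⟩
  refine Presieve.isSheafFor_subsieve_aux (S := .generate (.singleton f)) F ?_ ?_ ?_
  · change Sieve.generate _ ≤ S
    rw [Sieve.generate_le_iff]
    rintro _ _ ⟨⟩
    exact hf
  · rw [← Presieve.isSheafFor_iff_generate]
    exact hF f
  · intro Z g _
    -- The Ore square puts `a` in the pulled-back sieve, and restriction along `a` is injective.
    obtain ⟨W, a, b, hab⟩ := hD g f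
    refine fun x t₁ t₂ h₁ h₂ ↦ Presieve.isSeparatedFor_singleton.1 (hF a).isSeparatedFor ?_
    have ha : (Sieve.generate (.singleton f)).pullback g a := ⟨_, b, f, ⟨⟩, hab.symm⟩
    rw [h₁ a ha, h₂ a ha]

theorem isSheafFor_singleton_of_isSheaf_atomic {F : Dᵒᵖ ⥤ Type w}
    (hF : Presieve.IsSheaf (GrothendieckTopology.atomic hD) F) ⦃X Y : D⦄ (f : Y ⟶ X) :
    Presieve.IsSheafFor F (.singleton f) := by
  rw [Presieve.isSheafFor_iff_generate]
  exact hF _ (mem_atomic_of_hom hD (f := f) (Sieve.le_generate _ _ _ ⟨⟩))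

/-- Restriction maps of sheaves for the atomic topology are injective. -/
theorem injective_map_of_isSheaf_atomic {F : Dᵒᵖ ⥤ Type w}
    (hF : Presieve.IsSheaf (GrothendieckTopology.atomic hD) F) ⦃X Y : D⦄ (f : Y ⟶ X) :
    Function.Injective (F.map f.op) :=
  Presieve.isSeparatedFor_singleton.1 (isSheafFor_singleton_of_isSheaf_atomic hD hF f).isSeparatedFor

/-- If coincidences between restrictions of sections stabilize along a filtered diagram of
sheaves for the atomic topology, then the colimit of the underlying presheaves is a sheaf. -/
theorem isSheaf_atomic_of_isColimit {I : Type w'} [SmallCategory I] [IsFiltered I]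
    {F : I ⥤ Dᵒᵖ ⥤ Type w'}
    (hF : ∀ i, Presieve.IsSheaf (GrothendieckTopology.atomic hD) (F.obj i))
    (hstable : ∀ ⦃i₀ : I⦄ ⦃Y : D⦄ (y : (F.obj i₀).obj (.op Y)),
      ∃ (i : I) (u : i₀ ⟶ i), ∀ ⦃j : I⦄ (t : i ⟶ j) ⦃Z : D⦄ (a b : Z ⟶ Y),
        (F.obj j).map a.op ((F.map (u ≫ t)).app _ y) =
          (F.obj j).map b.op ((F.map (u ≫ t)).app _ y) →
        (F.obj i).map a.op ((F.map u).app _ y) = (F.obj i).map b.op ((F.map u).app _ y))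
    {c : Cocone F} (hc : IsColimit c) :
    Presieve.IsSheaf (GrothendieckTopology.atomic hD) c.pt := by
  have hcX (X : Dᵒᵖ) : IsColimit (((evaluation _ _).obj X).mapCocone c) :=
    isColimitOfPreserves _ hc
  have hw {i j : I} (t : i ⟶ j) {X : Dᵒᵖ} (x : (F.obj i).obj X) :
      (c.ι.app j).app X ((F.map t).app X x) = (c.ι.app i).app X x := by
    rw [← c.w t, NatTrans.comp_app, comp_apply]
  have hn (i : I) {V W : Dᵒᵖ} (g : V ⟶ W) (x : (F.obj i).obj V) :
      (c.ι.app i).app W ((F.obj i).map g x) = c.pt.map g ((c.ι.app i).app V x) :=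
    NatTrans.naturality_apply (c.ι.app i) g x
  refine isSheaf_atomic_of_singleton hD fun X Y f ↦ Presieve.isSheafFor_singleton.2 fun s hs ↦ ?_
  refine existsUnique_of_exists_of_unique ?_ ?_
  · obtain ⟨i₀, y, hy⟩ := Types.jointly_surjective_of_isColimit (hcX (.op Y)) s
    replace hy : (c.ι.app i₀).app _ y = s := hy
    -- The stage `i` serves all pairs `a`, `b` simultaneously, so descent along `f` applies in
    -- `F.obj i`.
    obtain ⟨i, u, hu⟩ := hstable y
    obtain ⟨x, hx, -⟩ := Presieve.isSheafFor_singleton.1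
      (isSheafFor_singleton_of_isSheaf_atomic hD (hF i) f) ((F.map u).app _ y) (by
        intro Z a b hab
        have h := hs a b hab
        rw [← hy, ← hw u, ← hn, ← hn] at h
        obtain ⟨j, t, ht⟩ := (Types.FilteredColimit.isColimit_eq_iff' (hcX (.op Z)) _ _).1 h
        refine hu t a b ?_
        simpa [NatTrans.naturality_apply] using ht)
    refine ⟨(c.ι.app i).app _ x, ?_⟩
    rw [← hn, hx, hw, hy]
  · intro x₁ x₂ h₁ h₂
    obtain ⟨i, x₁, x₂, rfl, rfl⟩ :=
      Types.FilteredColimit.jointly_surjective_of_isColimit₂ (hcX (.op X)) x₁ x₂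
    replace h₁ : c.pt.map f.op ((c.ι.app i).app _ x₁) = c.pt.map f.op ((c.ι.app i).app _ x₂) :=
      h₁.trans h₂.symm
    rw [← hn, ← hn] at h₁
    obtain ⟨j, t, ht⟩ := (Types.FilteredColimit.isColimit_eq_iff' (hcX (.op Y)) _ _).1 h₁
    replace ht : (F.map t).app _ ((F.obj i).map f.op x₁) =
      (F.map t).app _ ((F.obj i).map f.op x₂) := ht
    rw [NatTrans.naturality_apply, NatTrans.naturality_apply] at ht
    have := injective_map_of_isSheaf_atomic hD (hF j) f ht
    change (c.ι.app i).app _ x₁ = (c.ι.app i).app _ x₂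
    rw [← hw t, this, hw]

end Atomic

/-! ### Atoms and their sections -/

section Atoms

variable {D : Type u} [Category.{v} D] (hD : GrothendieckTopology.RightOreCondition D)

/-- The empty presheaf is a sheaf for the atomic topology. -/
theorem isSheaf_atomic_pempty :
    Presieve.IsSheaf (GrothendieckTopology.atomic hD)
      ((Functor.const Dᵒᵖ).obj (PEmpty.{w + 1} : Type w)) := by
  rintro X S ⟨Y, f, hf⟩ x
  exact (x f hf).elim

/-- An initial sheaf for the atomic topology has no sections. -/
theorem isEmpty_sections_of_isInitial
    {F : Sheaf (GrothendieckTopology.atomic hD) (Type w)} (hF : IsInitial F) (X : Dᵒᵖ) :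
    IsEmpty (F.obj.obj X) := by
  let E : Sheaf (GrothendieckTopology.atomic hD) (Type w) :=
    ⟨_, (isSheaf_iff_isSheaf_of_type _ _).2 (isSheaf_atomic_pempty hD)⟩
  exact ⟨fun x ↦ ((hF.to E).hom.app X x : PEmpty).elim⟩

/-- An atom of the topos of sheaves for the atomic topology has a section. -/
theorem exists_section_of_isAtomObject
    {F : Sheaf (GrothendieckTopology.atomic hD) (Type w)} (hF : isAtomObject _ F) :
    ∃ X : D, Nonempty (F.obj.obj (.op X)) := by
  by_contra! h
  refine hF.1.false (IsInitial.ofUniqueHom (fun G ↦ ⟨{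
    app X := ↾fun x ↦ ((h X.unop).false x).elim
    naturality X Y f := ?_ }⟩) fun G m ↦ ?_)
  · ext x
    exact ((h X.unop).false x).elim
  · ext X x
    exact ((h X.unop).false x).elim

/-- Any section of an atom locally generates it. -/
theorem exists_restriction_eq_of_isAtomObject
    {F : Sheaf (GrothendieckTopology.atomic hD) (Type w)} (hF : isAtomObject _ F)
    {X Y : D} (x : F.obj.obj (.op X)) (y : F.obj.obj (.op Y)) :
    ∃ (Z : D) (a : Z ⟶ X) (b : Z ⟶ Y), F.obj.map a.op x = F.obj.map b.op y := by
  -- The subsheaf generated by `x` is not initial, so it is all of `F`.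
  let G₀ : Subfunctor F.obj :=
    { obj W := {s | ∃ a : W.unop ⟶ X, F.obj.map a.op x = s}
      map := by
        rintro U V f _ ⟨a, rfl⟩
        exact ⟨f.unop ≫ a, by simp⟩ }
  have hF' := (isSheaf_iff_isSheaf_of_type _ _).1 F.property
  let G := G₀.sheafify (GrothendieckTopology.atomic hD)
  let U : Sheaf (GrothendieckTopology.atomic hD) (Type w) :=
    ⟨G.toFunctor, (isSheaf_iff_isSheaf_of_type _ _).2 (G₀.sheafify_isSheaf hF')⟩
  let ι : U ⟶ F := ⟨G.ι⟩
  have : Mono ι := (sheafToPresheaf _ _).mono_of_mono_map (inferInstanceAs (Mono G.ι))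
  obtain ⟨⟨h⟩⟩ | h := hF.2 ι
  · exact ((isEmpty_sections_of_isInitial hD h (.op X)).false
      ⟨x, G₀.le_sheafify _ _ ⟨𝟙 _, by simp⟩⟩).elim
  · have : F.obj.map (𝟙 _) y ∈ G.obj (.op Y) := by
      have h₁ : inv ι ≫ ι = 𝟙 F := by simp
      have h₂ : (ι.hom.app _ ((inv ι).hom.app (.op Y) y)) = y :=
        congr($(congrArg (fun m : F ⟶ F ↦ m.hom.app (.op Y)) h₁) y)
      rw [Functor.map_id_apply, ← h₂]
      exact ((inv ι).hom.app (.op Y) y).2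
    obtain ⟨Z, b, a, hab⟩ := this
    exact ⟨Z, a, b, by simpa using hab⟩

/-- A morphism of atoms is an isomorphism as soon as it does not create coincidences between the
restrictions of some section. -/
theorem isIso_of_isAtomObject {F G : Sheaf (GrothendieckTopology.atomic hD) (Type w)}
    (hF : isAtomObject _ F) (hG : isAtomObject _ G) (φ : F ⟶ G) {X : D} (x : F.obj.obj (.op X))
    (hx : ∀ ⦃Z : D⦄ (a b : Z ⟶ X),
      G.obj.map a.op (φ.hom.app _ x) = G.obj.map b.op (φ.hom.app _ x) →
      F.obj.map a.op x = F.obj.map b.op x) : IsIso φ := by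
  have : ∀ W, Mono (φ.hom.app W) := by
    intro W
    rw [mono_iff_injective]
    intro s t hst
    -- Over a common refinement, `s` and `t` both become restrictions of `x`, where `hx` applies.
    obtain ⟨Z, a, b, hab⟩ := exists_restriction_eq_of_isAtomObject hD hF x
      (Y := W.unop) s
    obtain ⟨Z', a', b', hab'⟩ := exists_restriction_eq_of_isAtomObject hD hF x
      (F.obj.map b.op t)
    have hF' := (isSheaf_iff_isSheaf_of_type _ _).1 F.property
    refine injective_map_of_isSheaf_atomic hD hF' (X := W.unop) (b' ≫ b) ?_
    have h₁ : F.obj.map (b' ≫ a).op x = F.obj.map (b' ≫ b).op s := by simp [hab]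
    have h₂ : F.obj.map a'.op x = F.obj.map (b' ≫ b).op t := by simp [hab']
    rw [← h₁, ← h₂]
    apply hx
    rw [← NatTrans.naturality_apply, ← NatTrans.naturality_apply, h₁, h₂,
      NatTrans.naturality_apply, NatTrans.naturality_apply]
    exact congrArg _ hst
  have : Mono φ.hom := NatTrans.mono_of_mono_app _
  have : Mono φ := (sheafToPresheaf _ _).mono_of_mono_map this
  refine (hG.2 φ).resolve_left fun ⟨h⟩ ↦ ?_
  exact (isEmpty_sections_of_isInitial hD h (.op X)).false x

end Atoms

/-- If the canonical functor preserves pushouts, then sheaves lift pushouts. -/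
theorem liftsPushouts_of_isSheaf {D : Type u} [SmallCategory D] (J : GrothendieckTopology D)
    [PreservesColimitsOfShape WalkingSpan (yoneda ⋙ presheafToSheaf J (Type u))]
    (F : Sheaf J (Type u)) : LiftsPushouts F.obj := by
  intro Z X Y P f g i j sq x y hxy
  let adj := sheafificationAdjunction J (Type u)
  let e (W : D) : ((yoneda ⋙ presheafToSheaf J (Type u)).obj W ⟶ F) ≃ F.obj.obj (.op W) :=
    (adj.homEquiv (yoneda.obj W) F).trans yonedaEquiv
  have he {V W : D} (h : V ⟶ W) (m : (yoneda ⋙ presheafToSheaf J (Type u)).obj W ⟶ F) :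
      e V ((yoneda ⋙ presheafToSheaf J (Type u)).map h ≫ m) = F.obj.map h.op (e W m) := by
    change yonedaEquiv (adj.homEquiv _ _ ((presheafToSheaf J (Type u)).map (yoneda.map h) ≫ m)) = _
    rw [adj.homEquiv_naturality_left]
    exact (yonedaEquiv_naturality _ _).symm
  have hw : (yoneda ⋙ presheafToSheaf J (Type u)).map f ≫ (e X).symm x =
      (yoneda ⋙ presheafToSheaf J (Type u)).map g ≫ (e Y).symm y := by
    apply (e Z).injective
    rw [he, he, Equiv.apply_symm_apply, Equiv.apply_symm_apply, hxy]
  have sq' := sq.map (yoneda ⋙ presheafToSheaf J (Type u))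
  refine ⟨e P (sq'.desc _ _ hw), ?_, ?_⟩
  · rw [← he, sq'.inl_desc, Equiv.apply_symm_apply]
  · rw [← he, sq'.inr_desc, Equiv.apply_symm_apply]

/-- Sheaves are reflective in a locally finitely presentable presheaf category, and local
presentability passes to a reflective subcategory with accessible inclusion. -/
theorem isLocallyFinitelyPresentable_of_preservesFilteredColimits {D : Type u} [SmallCategory D]
    (J : GrothendieckTopology D)
    [PreservesFilteredColimitsOfSize.{u, u} (sheafToPresheaf J (Type u))] :
    IsLocallyFinitelyPresentable.{u} (Sheaf J (Type u)) := by
  have := Cardinal.fact_isRegular_aleph0.{u}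
  have : (sheafToPresheaf J (Type u)).IsCardinalAccessible Cardinal.aleph0.{u} :=
    Functor.IsFinitelyAccessible_iff_preservesFilteredColimitsOfSize.2 inferInstance
  exact (sheafificationAdjunction J (Type u)).isCardinalLocallyPresentable _

end AtomicTopos

theorem mainTheorem2 {C : Type u} [SmallCategory C]
    (hC : AtomicTopos.HasAmalgamation C)
    (hFull : (AtomicTopos.sheafifiedYoneda hC).Full)
    (hFaithful : (AtomicTopos.sheafifiedYoneda hC).Faithful)
    (hAtom : ∀ X : Cᵒᵖ, AtomicTopos.isAtomObject (AtomicTopos.AtomicSheaves hC)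
      ((AtomicTopos.sheafifiedYoneda hC).obj X))
    (hPushouts : HasPushouts Cᵒᵖ)
    (hPreserves : PreservesColimitsOfShape WalkingSpan (AtomicTopos.sheafifiedYoneda hC))
    (hWellFounded : AtomicTopos.IsWellFounded.{w} C)
    (hNoetherian : ∀ X : C, AtomicTopos.IsNoetherianGroup (Aut X)) :
    AtomicTopos.IsCoWellFounded.{w'} (AtomicTopos.Atoms (AtomicTopos.AtomicSheaves hC)) ∧
      IsLocallyFinitelyPresentable.{u} (AtomicTopos.AtomicSheaves hC) := by
  have hAut (X : Cᵒᵖ) : AtomicTopos.IsNoetherianGroup (Aut X) :=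
    (hNoetherian X.unop).of_mulEquiv (AtomicTopos.autUnopEquiv X)
  have hLifts (F : AtomicTopos.AtomicSheaves hC) : AtomicTopos.LiftsPushouts F.obj :=
    AtomicTopos.liftsPushouts_of_isSheaf _ F
  refine ⟨fun I _ _ _ F ↦ ?_, ?_⟩
  · let F' := F ⋙ ObjectProperty.ι _ ⋙ sheafToPresheaf _ _
    have i₀ : I := Classical.arbitrary I
    obtain ⟨Y, ⟨y⟩⟩ := AtomicTopos.exists_section_of_isAtomObject hC.rightOre (F.obj i₀).property
    obtain ⟨i, u, hi⟩ := AtomicTopos.exists_stable_coincidences hWellFounded hAut F'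
      (fun i ↦ hLifts _) (i₀ := i₀) y
    refine ⟨i, fun j hij ↦ ?_⟩
    have : IsIso (F.map (homOfLE hij.le)).hom := by
      refine AtomicTopos.isIso_of_isAtomObject hC.rightOre (F.obj i).property (F.obj j).property _
        ((F'.map u).app _ y) fun Z a b hab ↦ hi (homOfLE hij.le) a b ?_
      rw [F'.map_comp]
      exact hab
    have : IsIso ((ObjectProperty.ι _).map (F.map (homOfLE hij.le))) := this
    exact isIso_of_reflects_iso _ (ObjectProperty.ι _)
  · have : PreservesFilteredColimitsOfSize.{u, u}
        (sheafToPresheaf (AtomicTopos.atomicTopology hC) (Type u)) := by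
      refine ⟨fun I _ _ ↦ ⟨fun {K} ↦ ?_⟩⟩
      have h : Presieve.IsSheaf (AtomicTopos.atomicTopology hC)
          (colimit (K ⋙ sheafToPresheaf _ _)) :=
        AtomicTopos.isSheaf_atomic_of_isColimit hC.rightOre
          (fun i ↦ (isSheaf_iff_isSheaf_of_type _ _).1 (K.obj i).property)
          (fun i₀ Y y ↦ AtomicTopos.exists_stable_coincidences hWellFounded hAut
            (K ⋙ sheafToPresheaf _ _) (fun i ↦ hLifts _) y) (colimit.isColimit _)
      -- The presheaf colimit, being a sheaf, is also the colimit of sheaves.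
      have : CreatesColimit K (sheafToPresheaf (AtomicTopos.atomicTopology hC) (Type u)) :=
        createsColimitOfFullyFaithfulOfIso
          ⟨_, (isSheaf_iff_isSheaf_of_type _ _).2 h⟩ (Iso.refl _)
      infer_instance
    exact AtomicTopos.isLocallyFinitelyPresentable_of_preservesFilteredColimits _
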